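/- A finite mixed graph $G$ has a finite vertex set $V(G)$, undirected edges and arcs (directed edges); undirected graphs (no arcs) and directed graphs (no undirected edges) are special cases. A directed path may use an edge in either direction and an arc only in its own direction; its length is the number of its edges and arcs. $G$ is called distance well-defined if it is nonempty and for all vertices $u,v$ there is a directed path from $u$ to $v$ (that is, $G$ is a connected undirected graph, a strongly connected directed graph or a strongly connected mixed graph). A cut vertex of a graph is a vertex whose deletion leaves a disconnected graph, connectedness being that of the underlying undirected graph. A block of $G$ is a distance well-defined subgraph of $G$ with at least two vertices and no cut vertex which is maximal, with respect to inclusion of subgraphs, with these properties. Let $R$ be a commutative ring with identity, and let $\mathbf j$ denote all-ones column vectors. A generalized distance matrix of $G$ over $R$ is a matrix $D=(D_{uv})_{u,v\in V(G)}$ with entries in $R$ such that (1) $D_{uu}=0$ for all $u$, and (2) $D_{uv}=D_{ux}+D_{xv}$ whenever $u,v$ are vertices and $x$ is a cut vertex of $G$ such that every shortest directed path from $u$ to $v$ passes through $x$. A bag $(A,\lambda,\alpha,\beta,L)$ of size $n$ consists of $A,L\in R^{n\times n}$, $\lambda\in R$ and column vectors $\alpha,\beta\in R^n$. It is a left $\mathrm{LapExp}^*$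 bag if $$\alpha^T\mathbf j=1,\quad L\mathbf j=\mathbf 0,\quad \alpha^TA=\lambda\mathbf j^T,\quad LA+I=\beta\mathbf j^T,$$ and a right $\mathrm{LapExp}^*$ bag if $$\mathbf j^T\beta=1,\quad \mathbf j^TL=\mathbf 0,\quad A\beta=\lambda\mathbf j,\quad AL+I=\mathbf j\alpha^T.$$ **Theorem 3.3.** Let $G$ be a distance well-defined graph, let $G_1,\dots,G_r$ be all its blocks (listed without repetition; $r=0$ if $G$ has a single vertex), and let $D$ be a generalized distance matrix of $G$ over $R$. For each $i$ let $D_i$ be the submatrix of $D$ with rows and columns indexed by $V(G_i)$, and let $(D_i,\lambda_i,\alpha_i,\beta_i,L_i)$ be a bag indexed by $V(G_i)$. Define the composition bag $(D,\lambda,\alpha,\beta,L)$, indexed by $V(G)$, by $$\lambda=\sum_{i=1}^r\lambda_i,\qquad \alpha_v=\sum_{i:\,v\in V(G_i)}(\alpha_i)_v-b(v)+1,\qquad \beta_v=\sum_{i:\,v\in V(G_i)}(\beta_i)_v-b(v)+1,\qquad L_{uv}=\sum_{i:\,u,v\in V(G_i)}(L_i)_{uv},$$ where $b(v)$ is the number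 of indices $i$ with $v\in V(G_i)$. If every $(D_i,\lambda_i,\alpha_i,\beta_i,L_i)$ is a left (respectively, right) $\mathrm{LapExp}^*$ bag, then $(D,\lambda,\alpha,\beta,L)$ is a left (respectively, right) $\mathrm{LapExp}^*$ bag. If moreover $\lambda$ is invertible in $R$, then $D$ is invertible and $$D^{-1}=-L+\frac1\lambda\,\beta\alpha^T.$$ -/

import Mathlib

/-- A finite mixed graph, with vertices taken from the type `V`: it has undirected edges and
arcs.  Undirected graphs are those without arcs, directed graphs are those without edges.
Opposite arcs (directed cycles of length two) are allowed. -/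
@[ext]
structure MixedGraph (V : Type*) where
  /-- the vertex set -/
  verts : Finset V
  /-- there is an undirected edge between `u` and `v` -/
  edge : V → V → Prop
  /-- there is an arc from `u` to `v` -/
  arc : V → V → Prop
  edge_symm : ∀ u v, edge u v → edge v u
  edge_mem : ∀ u v, edge u v → u ∈ verts ∧ v ∈ verts
  arc_mem : ∀ u v, arc u v → u ∈ verts ∧ v ∈ verts

namespace MixedGraph

/-- `H ≤ G` means that `H` is a subgraph of `G`. -/
instance {V : Type*} : PartialOrder (MixedGraph V) where
  le H G := H.verts ⊆ G.verts ∧ (∀ u v, H.edge u v → G.edge u v) ∧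
    (∀ u v, H.arc u v → G.arc u v)
  le_refl H := ⟨fun _ h => h, fun _ _ h => h, fun _ _ h => h⟩
  le_trans _ _ _ h k :=
    ⟨fun _ hx => k.1 (h.1 hx), fun u v hx => k.2.1 u v (h.2.1 u v hx),
      fun u v hx => k.2.2 u v (h.2.2 u v hx)⟩
  le_antisymm H G h k := by
    refine MixedGraph.ext (Finset.Subset.antisymm h.1 k.1) ?_ ?_
    · funext u v
      exact propext ⟨h.2.1 u v, k.2.1 u v⟩
    · funext u v
      exact propext ⟨h.2.2 u v, k.2.2 u v⟩

/-- One can move from `u` to `v` in one step: along an edge, or along an arc in its direction. -/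
def Step {V : Type*} (G : MixedGraph V) (u v : V) : Prop := G.edge u v ∨ G.arc u v

/-- `p` is the list of successive vertices of a (directed) path from `u` to `v` in `G`. -/
structure IsPath {V : Type*} (G : MixedGraph V) (u v : V) (p : List V) : Prop where
  head : p.head? = some u
  last : p.getLast? = some v
  chain : p.IsChain G.Step
  nodup : p.Nodup
  mem : ∀ w ∈ p, w ∈ G.verts

/-- `p` is a shortest (directed) path from `u` to `v` (the number of edges and arcs of a path is
one less than the number of its vertices). -/
def IsShortestPath {V : Type*} (G : MixedGraph V) (u v : V) (p : List V) : Prop :=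
  G.IsPath u v p ∧ ∀ q, G.IsPath u v q → p.length ≤ q.length

/-- Distance well-defined graphs: nonempty and strongly connected, i.e. every vertex can be
reached from every vertex.  For a graph without arcs this is ordinary connectedness. -/
def DistanceWellDefined {V : Type*} (G : MixedGraph V) : Prop :=
  G.verts.Nonempty ∧ ∀ u ∈ G.verts, ∀ v ∈ G.verts, Relation.ReflTransGen G.Step u v

/-- `G` is disconnected: some two vertices are not joined by a path in the underlying undirected
graph (where directions are ignored). -/
def Disconnected {V : Type*} (G : MixedGraph V) : Prop :=
  ∃ u ∈ G.verts, ∃ v ∈ G.verts,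
    ¬ Relation.ReflTransGen (fun a b => G.Step a b ∨ G.Step b a) u v

/-- The graph `G - x`. -/
def deleteVertex {V : Type*} [DecidableEq V] (G : MixedGraph V) (x : V) : MixedGraph V where
  verts := G.verts.erase x
  edge u v := G.edge u v ∧ u ≠ x ∧ v ≠ x
  arc u v := G.arc u v ∧ u ≠ x ∧ v ≠ x
  edge_symm u v h := ⟨G.edge_symm u v h.1, h.2.2, h.2.1⟩
  edge_mem u v h := ⟨Finset.mem_erase.2 ⟨h.2.1, (G.edge_mem u v h.1).1⟩,
    Finset.mem_erase.2 ⟨h.2.2, (G.edge_mem u v h.1).2⟩⟩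
  arc_mem u v h := ⟨Finset.mem_erase.2 ⟨h.2.1, (G.arc_mem u v h.1).1⟩,
    Finset.mem_erase.2 ⟨h.2.2, (G.arc_mem u v h.1).2⟩⟩

/-- `x` is a cut vertex of `G`. -/
def IsCutVertex {V : Type*} [DecidableEq V] (G : MixedGraph V) (x : V) : Prop :=
  x ∈ G.verts ∧ (G.deleteVertex x).Disconnected

/-- `H` is a block of `G`: a distance well-defined subgraph on at least two vertices without cut
vertices, maximal (as a subgraph) with respect to these properties. -/
def IsBlock {V : Type*} [DecidableEq V] (G H : MixedGraph V) : Prop :=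
  Maximal (fun K : MixedGraph V =>
    K ≤ G ∧ K.DistanceWellDefined ∧ 2 ≤ K.verts.card ∧ ∀ x, ¬ K.IsCutVertex x) H

/-- An enumeration, without repetition, of all the blocks of `G` by the index type `ι`. -/
structure Blocks {V : Type*} [DecidableEq V] (G : MixedGraph V) (ι : Type*) where
  block : ι → MixedGraph V
  injective : Function.Injective block
  isBlock_iff : ∀ H, G.IsBlock H ↔ ∃ i, block i = H

theorem Blocks.block_le {V : Type*} [DecidableEq V] {G : MixedGraph V} {ι : Type*}
    (S : G.Blocks ι) (i : ι) : S.block i ≤ G :=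
  ((S.isBlock_iff (S.block i)).2 ⟨i, rfl⟩).1.1

/-- Generalized distance matrices of `G` over a commutative ring. -/
structure IsGeneralizedDistanceMatrix {V : Type*} [DecidableEq V] {R : Type*} [CommRing R]
    (G : MixedGraph V) (D : Matrix G.verts G.verts R) : Prop where
  diag : ∀ u, D u u = 0
  cut : ∀ u v x : G.verts, G.IsCutVertex x →
    (∀ p, G.IsShortestPath u v p → (x : V) ∈ p) → D u v = D u x + D x v

/-- The submatrix of `M` whose rows and columns correspond to the vertices of the subgraph `H`. -/
def sub {V : Type*} {R : Type*} {G H : MixedGraph V} (M : Matrix G.verts G.verts R)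
    (h : H ≤ G) : Matrix H.verts H.verts R :=
  fun u v => M ⟨u, h.1 u.2⟩ ⟨v, h.1 v.2⟩

end MixedGraph

/-- A bag `(A, lam, α, β, L)` with rows and columns indexed by `n`. -/
structure Bag (n : Type*) (R : Type*) where
  A : Matrix n n R
  lam : R
  α : n → R
  β : n → R
  L : Matrix n n R

namespace Bag

/-- A left LapExp* bag:
`αᵀ j = 1`, `L j = 0`, `αᵀ A = lam jᵀ` and `L A + I = β jᵀ`, where `j` is the all-ones vector. -/
structure IsLeftLapExp {n R : Type*} [Fintype n] [DecidableEq n] [CommRing R]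
    (B : Bag n R) : Prop where
  α_one : B.α ⬝ᵥ 1 = 1
  L_one : Matrix.mulVec B.L 1 = 0
  α_A : Matrix.vecMul B.α B.A = B.lam • (1 : n → R)
  L_A : B.L * B.A + 1 = Matrix.vecMulVec B.β 1

/-- A right LapExp* bag:
`jᵀ β = 1`, `jᵀ L = 0`, `A β = lam j` and `A L + I = j αᵀ`, where `j` is the all-ones vector. -/
structure IsRightLapExp {n R : Type*} [Fintype n] [DecidableEq n] [CommRing R]
    (B : Bag n R) : Prop where
  one_β : 1 ⬝ᵥ B.β = 1
  one_L : Matrix.vecMul 1 B.L = 0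
  A_β : Matrix.mulVec B.A B.β = B.lam • (1 : n → R)
  A_L : B.A * B.L + 1 = Matrix.vecMulVec 1 B.α

end Bag

namespace MixedGraph

/-- Extension by zero of a vector indexed by the vertices of `H`. -/
def extendVec {V : Type*} [DecidableEq V] {R : Type*} [Zero R] (H : MixedGraph V)
    (a : H.verts → R) (v : V) : R :=
  if h : v ∈ H.verts then a ⟨v, h⟩ else 0

/-- Extension by zero of a matrix indexed by the vertices of `H`. -/
def extendMat {V : Type*} [DecidableEq V] {R : Type*} [Zero R] (H : MixedGraph V)
    (M : Matrix H.verts H.verts R) (u v : V) : R :=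
  if h : u ∈ H.verts ∧ v ∈ H.verts then M ⟨u, h.1⟩ ⟨v, h.2⟩ else 0

namespace Blocks

/-- The block index set of `v`: the indices of the blocks that contain `v`. -/
def blockIndexSet {V : Type*} [DecidableEq V] {G : MixedGraph V} {ι : Type*} [Fintype ι]
    (S : G.Blocks ι) (v : V) : Finset ι :=
  Finset.univ.filter fun i => v ∈ (S.block i).verts

/-- The block index of `v`: the number of blocks that contain `v`. -/
def blockIndex {V : Type*} [DecidableEq V] {G : MixedGraph V} {ι : Type*} [Fintype ι]
    (S : G.Blocks ι) (v : V) : ℕ :=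
  (S.blockIndexSet v).card

/-- The composition bag, with first component `D`, of a family of bags on the blocks of `G`. -/
def compositionBag {V : Type*} [DecidableEq V] {R : Type*} [CommRing R] {G : MixedGraph V}
    {ι : Type*} [Fintype ι] (S : G.Blocks ι) (D : Matrix G.verts G.verts R)
    (B : ∀ i, Bag (S.block i).verts R) : Bag G.verts R where
  A := D
  lam := ∑ i, (B i).lam
  α v := (∑ i ∈ S.blockIndexSet v, (S.block i).extendVec (B i).α v) - (S.blockIndex v : R) + 1
  β v := (∑ i ∈ S.blockIndexSet v, (S.block i).extendVec (B i).β v) - (S.blockIndex v : R) + 1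
  L u v := ∑ i, (S.block i).extendMat (B i).L u v

end Blocks

end MixedGraph

/-!
The idea is that a block `H`, seen from a vertex `v`, has a single entrance: a *gate* `p` in `H`
through which every walk from `v` to `H` passes (`IsGate`; `p = v` if `v` lies in `H`). Unless the
situation is degenerate, the gate is a cut vertex, so the entries of `D` split there:
`D w v = D w p + D p v` for all `w` in `H`, and likewise for `D v w`
(`IsGeneralizedDistanceMatrix.split`). Hence a column of `D` restricted to `H` is a column of
`D_H` plus a constant, and the bag identities of `H` evaluate every product of `α_H` or `L_H` with
it. Among the blocks at `u ≠ v` exactly one has a gate for `v` different from `u`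
(`existsUnique_gate_ne`), so `b(u) - 1` counts the blocks whose gate for `v` is `u`. With the
coefficients `1 - b(u)` rewritten in this way, all sums cancel block by block, without an
induction on the number of blocks (`Bag.isLeftLapExp_of_gates`). The right-handed statement
is the left-handed one for the transposed bags, and the formula for the inverse is a one-line
consequence of the bag identities.

The graph theory rests on a description of the blocks: they are the graphs induced on the maximal
inseparable vertex sets with at least two elements (`isBlock_induce`, `IsBlock.exists_eq_induce`).
Sending each vertex of `G` to its gate in such a set `S` contracts every edge outside `S`, and so
turns walks of `G` into walks inside `S`. Directed walks show that the induced graph is strongly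
connected, and walks avoiding a vertex `x` show that it has no cut vertex. Therefore the definition
of blocks by strongly connected subgraphs gives the blocks of the underlying undirected graph.
-/

/-! ### Connectedness, inseparable sets and gates: definitions -/

namespace MixedGraph

/-- Adjacency in the underlying undirected graph. -/
def Adj {V : Type*} (G : MixedGraph V) (a b : V) : Prop := G.Step a b ∨ G.Step b a

/-- `a` and `b` are joined by a walk of the underlying undirected graph that avoids `x`.
The empty walk counts as avoiding `x` even when `a = b = x`, so this is meaningful only for
`a ≠ x`. -/
def ConnAvoiding {V : Type*} (G : MixedGraph V) (x a b : V) : Prop :=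
  Relation.ReflTransGen (fun c d => G.Adj c d ∧ c ≠ x ∧ d ≠ x) a b

/-- A set of vertices is inseparable if no two of its members can be separated by deleting a
third vertex of the graph (which may or may not belong to the set). -/
def Inseparable {V : Type*} (G : MixedGraph V) (S : Finset V) : Prop :=
  S ⊆ G.verts ∧ ∀ a ∈ S, ∀ b ∈ S, ∀ x, a ≠ x → b ≠ x → G.ConnAvoiding x a b

/-- `p` is a gate of `S` as seen from `v`: it lies in `S`, and every walk of the underlying
undirected graph from `v` to a member of `S` passes through `p`. For `v ∈ S` this forces
`p = v`. -/
def IsGate {V : Type*} (G : MixedGraph V) (S : Finset V) (v p : V) : Prop :=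
  p ∈ S ∧ ∀ w ∈ S, w ≠ p → v ≠ p → ¬ G.ConnAvoiding p v w

/-- The subgraph of `G` induced on the vertices of `G` that lie in `S`. -/
def induce {V : Type*} [DecidableEq V] (G : MixedGraph V) (S : Finset V) : MixedGraph V where
  verts := G.verts ∩ S
  edge u v := G.edge u v ∧ u ∈ S ∧ v ∈ S
  arc u v := G.arc u v ∧ u ∈ S ∧ v ∈ S
  edge_symm u v h := ⟨G.edge_symm u v h.1, h.2.2, h.2.1⟩
  edge_mem u v h := ⟨Finset.mem_inter.2 ⟨(G.edge_mem u v h.1).1, h.2.1⟩,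
    Finset.mem_inter.2 ⟨(G.edge_mem u v h.1).2, h.2.2⟩⟩
  arc_mem u v h := ⟨Finset.mem_inter.2 ⟨(G.arc_mem u v h.1).1, h.2.1⟩,
    Finset.mem_inter.2 ⟨(G.arc_mem u v h.1).2, h.2.2⟩⟩

/-! ### Walks avoiding a vertex -/

theorem Step.mem {V : Type*} {G : MixedGraph V} {a b : V} (h : G.Step a b) :
    a ∈ G.verts ∧ b ∈ G.verts :=
  h.elim (G.edge_mem a b) (G.arc_mem a b)

theorem Adj.symm {V : Type*} {G : MixedGraph V} {a b : V} (h : G.Adj a b) : G.Adj b a :=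
  Or.symm h

theorem Adj.mem {V : Type*} {G : MixedGraph V} {a b : V} (h : G.Adj a b) :
    a ∈ G.verts ∧ b ∈ G.verts :=
  h.elim Step.mem fun h => (Step.mem h).symm

theorem ConnAvoiding.refl {V : Type*} (G : MixedGraph V) (x a : V) : G.ConnAvoiding x a a :=
  Relation.ReflTransGen.refl

theorem ConnAvoiding.symm {V : Type*} {G : MixedGraph V} {x a b : V}
    (h : G.ConnAvoiding x a b) : G.ConnAvoiding x b a :=
  (@Relation.ReflTransGen.stdSymm _ _ ⟨fun _ _ h => ⟨h.1.symm, h.2.2, h.2.1⟩⟩).symm _ _ h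

theorem ConnAvoiding.trans {V : Type*} {G : MixedGraph V} {x a b c : V}
    (h : G.ConnAvoiding x a b) (k : G.ConnAvoiding x b c) : G.ConnAvoiding x a c :=
  Relation.ReflTransGen.trans h k

theorem Adj.connAvoiding {V : Type*} {G : MixedGraph V} {x a b : V} (h : G.Adj a b)
    (ha : a ≠ x) (hb : b ≠ x) : G.ConnAvoiding x a b :=
  Relation.ReflTransGen.single ⟨h, ha, hb⟩

theorem ConnAvoiding.mono {V : Type*} {G H : MixedGraph V} (hH : H ≤ G) {x a b : V}
    (h : H.ConnAvoiding x a b) : G.ConnAvoiding x a b :=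
  Relation.ReflTransGen.mono (fun c d hcd => ⟨hcd.1.imp
    (fun h => h.imp (hH.2.1 c d) (hH.2.2 c d)) (fun h => h.imp (hH.2.1 d c) (hH.2.2 d c)),
    hcd.2⟩) _ _ h

/-- Connectedness of `G - x` is connectedness by walks of `G` avoiding `x`. -/
theorem deleteVertex_disconnected_iff {V : Type*} [DecidableEq V] {G : MixedGraph V} {x : V} :
    (G.deleteVertex x).Disconnected ↔
      ∃ u ∈ G.verts, ∃ v ∈ G.verts, u ≠ x ∧ v ≠ x ∧ ¬ G.ConnAvoiding x u v := by
  have key : (fun a b => (G.deleteVertex x).Step a b ∨ (G.deleteVertex x).Step b a) =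
      fun a b => G.Adj a b ∧ a ≠ x ∧ b ≠ x := by
    funext a b
    simp only [Step, deleteVertex, Adj, eq_iff_iff]
    tauto
  rw [Disconnected, key]
  simp only [deleteVertex, Finset.mem_erase]
  constructor
  · rintro ⟨u, hu, v, hv, h⟩
    exact ⟨u, hu.2, v, hv.2, hu.1, hv.1, h⟩
  · rintro ⟨u, hu, v, hv, hux, hvx, h⟩
    exact ⟨u, ⟨hux, hu⟩, v, ⟨hvx, hv⟩, h⟩

theorem DistanceWellDefined.reachable {V : Type*} {G : MixedGraph V}
    (hG : G.DistanceWellDefined) {u v : V} (hu : u ∈ G.verts) (hv : v ∈ G.verts) :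
    Relation.ReflTransGen G.Adj u v :=
  Relation.ReflTransGen.mono (fun _ _ => Or.inl) _ _ (hG.2 u hu v hv)

/-- A directed path that avoids `x` is a walk that avoids `x`. -/
theorem IsPath.connAvoiding {V : Type*} {G : MixedGraph V} {u v x : V} {p : List V}
    (hp : G.IsPath u v p) (hx : x ∉ p) : G.ConnAvoiding x u v := by
  obtain ⟨head, last, chain, -, -⟩ := hp
  induction p generalizing u with
  | nil => simp at head
  | cons a t ih =>
    obtain rfl : a = u := by simpa using head
    cases t with
    | nil =>
      obtain rfl : a = v := by simpa using last
      exact .refl _ _ _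
    | cons b t =>
      rw [List.isChain_cons_cons] at chain
      simp only [List.mem_cons, not_or] at hx
      exact (Adj.connAvoiding (Or.inl chain.1) (Ne.symm hx.1) (Ne.symm hx.2.1)).trans
        (ih (by simpa using hx.2) rfl (by simpa using last) chain.2)

/-! ### Maximal inseparable sets and their gates -/

/-- Adjacent vertices are inseparable. -/
theorem Adj.inseparable {V : Type*} [DecidableEq V] {G : MixedGraph V} {a b : V}
    (h : G.Adj a b) : G.Inseparable {a, b} := by
  refine ⟨by simpa [Finset.insert_subset_iff] using h.mem, ?_⟩
  simp only [Finset.mem_insert, Finset.mem_singleton]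
  rintro c (rfl | rfl) d (rfl | rfl) x hc hd
  · exact .refl _ _ _
  · exact h.connAvoiding hc hd
  · exact h.symm.connAvoiding hc hd
  · exact .refl _ _ _

theorem Inseparable.exists_maximal {V : Type*} {G : MixedGraph V} {S : Finset V}
    (h : G.Inseparable S) : ∃ T, S ⊆ T ∧ Maximal G.Inseparable T :=
  Set.Finite.exists_le_maximal (s := {S | G.Inseparable S})
    (G.verts.powerset.finite_toSet.subset fun _ hT => Finset.mem_powerset.2 hT.1) h

/-- Two inseparable sets that share `u` and have members connected outside `u` have an
inseparable union: a vertex other than `u` fails to separate them because both contain `u`. -/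
theorem Inseparable.union {V : Type*} [DecidableEq V] {G : MixedGraph V} {S T : Finset V}
    (hS : G.Inseparable S) (hT : G.Inseparable T) {u s t : V} (huS : u ∈ S) (huT : u ∈ T)
    (hs : s ∈ S) (ht : t ∈ T) (hsu : s ≠ u) (htu : t ≠ u) (hst : G.ConnAvoiding u s t) :
    G.Inseparable (S ∪ T) := by
  have key : ∀ a ∈ S, ∀ b ∈ T, ∀ x, a ≠ x → b ≠ x → G.ConnAvoiding x a b := by
    intro a ha b hb x hax hbx
    by_cases hux : u = x
    · subst hux
      exact ((hS.2 a ha s hs u hax hsu).trans hst).trans (hT.2 t ht b hb u htu hbx)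
    · exact (hS.2 a ha u huS x hax hux).trans (hT.2 u huT b hb x hux hbx)
  refine ⟨Finset.union_subset hS.1 hT.1, ?_⟩
  intro a ha b hb x hax hbx
  rcases Finset.mem_union.1 ha with ha | ha <;> rcases Finset.mem_union.1 hb with hb | hb
  · exact hS.2 a ha b hb x hax hbx
  · exact key a ha b hb x hax hbx
  · exact (key b hb a ha x hbx hax).symm
  · exact hT.2 a ha b hb x hax hbx

theorem eq_of_maximal_inseparable {V : Type*} [DecidableEq V] {G : MixedGraph V}
    {S T : Finset V} (hS : Maximal G.Inseparable S) (hT : Maximal G.Inseparable T) {u s t : V}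
    (huS : u ∈ S) (huT : u ∈ T) (hs : s ∈ S) (ht : t ∈ T) (hsu : s ≠ u) (htu : t ≠ u)
    (hst : G.ConnAvoiding u s t) : S = T := by
  have h := hS.prop.union hT.prop huS huT hs ht hsu htu hst
  exact (hS.eq_of_le h Finset.subset_union_left).trans
    (hT.eq_of_le h Finset.subset_union_right).symm

theorem isGate_self {V : Type*} {G : MixedGraph V} {S : Finset V} {v : V} (hv : v ∈ S) :
    G.IsGate S v v :=
  ⟨hv, fun _ _ _ h => absurd rfl h⟩

theorem IsGate.eq_of_mem {V : Type*} {G : MixedGraph V} {S : Finset V} {v p : V}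
    (h : G.IsGate S v p) (hv : v ∈ S) : v = p := by
  by_contra hne
  exact h.2 v hv hne hne (.refl _ _ _)

theorem IsGate.of_adj {V : Type*} {G : MixedGraph V} {S : Finset V} {v w p : V}
    (h : G.IsGate S v p) (hvw : G.Adj v w) (hv : v ≠ p) (hw : w ≠ p) : G.IsGate S w p :=
  ⟨h.1, fun s hs hsp _ hc => h.2 s hs hsp hv ((hvw.connAvoiding hv hw).trans hc)⟩

/-- A gate `p` can be reached while avoiding any other member `s` of the set: a walk from `v`
meets `p` before `s`. -/
theorem IsGate.connAvoiding {V : Type*} {G : MixedGraph V} {S : Finset V} {v p s : V}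
    (h : G.IsGate S v p) (hr : Relation.ReflTransGen G.Adj v p) (hs : s ∈ S) (hsp : s ≠ p)
    (hvs : v ≠ s) : G.ConnAvoiding s v p := by
  by_contra hcon
  have hvp : v ≠ p := by
    rintro rfl
    exact hcon (.refl _ _ _)
  have hnot := h.2 s hs hsp hvp
  -- Otherwise no walk from `v` ever meets `s` or `p`.
  have key : ∀ z, Relation.ReflTransGen G.Adj v z →
      z ≠ s ∧ z ≠ p ∧ G.ConnAvoiding s v z ∧ G.ConnAvoiding p v z := by
    intro z hz
    induction hz with
    | refl => exact ⟨hvs, hvp, .refl _ _ _, .refl _ _ _⟩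
    | @tail y z _ hyz ih =>
      obtain ⟨hys, hyp, h1, h2⟩ := ih
      have hzs : z ≠ s := by
        rintro rfl
        exact hnot (h2.trans (hyz.connAvoiding hyp hsp))
      have hzp : z ≠ p := by
        rintro rfl
        exact hcon (h1.trans (hyz.connAvoiding hys hzs))
      exact ⟨hzs, hzp, h1.trans (hyz.connAvoiding hys hzs),
        h2.trans (hyz.connAvoiding hyp hzp)⟩
  exact (key p hr).2.1 rfl

theorem IsGate.unique {V : Type*} {G : MixedGraph V} {S : Finset V} {v p q : V}
    (hp : G.IsGate S v p) (hq : G.IsGate S v q) (hr : Relation.ReflTransGen G.Adj v p) :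
    p = q := by
  by_contra hne
  by_cases hvq : v = q
  · subst hvq
    exact hne (hp.eq_of_mem hq.1).symm
  · exact hq.2 p hp.1 hne hvq (hp.connAvoiding hr hq.1 (Ne.symm hne) hvq)

/-- The existence of a gate propagates along adjacency. The essential case is that of an edge
leaving `S` at `v`: if its end `w` could reach the rest of `S` without `v`, then adding `w` to
`S` would keep it inseparable. -/
theorem exists_isGate {V : Type*} [DecidableEq V] {G : MixedGraph V} {S : Finset V}
    (hS : Maximal G.Inseparable S) {s v : V} (hs : s ∈ S)
    (hr : Relation.ReflTransGen G.Adj s v) : ∃ p, G.IsGate S v p := by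
  induction hr with
  | refl => exact ⟨s, isGate_self hs⟩
  | @tail v w _ hvw ih =>
    obtain ⟨p, hp⟩ := ih
    by_cases hw : w ∈ S
    · exact ⟨w, isGate_self hw⟩
    have hwp : w ≠ p := by
      rintro rfl
      exact hw hp.1
    by_cases hvp : v = p
    · subst hvp
      refine ⟨v, hp.1, fun t ht htv _ hc => hw ?_⟩
      have hins := hS.prop.union hvw.inseparable hp.1 (by simp) ht (t := w) (by simp) htv hwp
        hc.symm
      rw [hS.eq_of_le hins Finset.subset_union_left]
      simp
    · exact ⟨p, hp.of_adj hvw hvp hwp⟩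

/-- Sending each vertex to its gate contracts every edge that is not inside `S`. -/
theorem IsGate.eq_of_adj {V : Type*} {G : MixedGraph V} {S : Finset V} {v w p q : V}
    (hp : G.IsGate S v p) (hq : G.IsGate S w q) (hvw : G.Adj v w)
    (hr : Relation.ReflTransGen G.Adj w p) (hnot : ¬ (v ∈ S ∧ w ∈ S)) : p = q := by
  by_cases hv : v ∈ S
  · obtain rfl := hp.eq_of_mem hv
    by_contra hne
    have hwq : w ≠ q := by
      rintro rfl
      exact hnot ⟨hv, hq.1⟩
    exact hq.2 v hv hne hwq (hvw.symm.connAvoiding hwq hne)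
  · have hvp : v ≠ p := by
      rintro rfl
      exact hv hp.1
    by_cases hwp : w = p
    · subst hwp
      exact hq.eq_of_mem hp.1
    · exact (hp.of_adj hvw hvp hwp).unique hq hr

/-! ### Blocks are the graphs induced on maximal inseparable sets -/

theorem induce_le {V : Type*} [DecidableEq V] (G : MixedGraph V) (S : Finset V) :
    G.induce S ≤ G :=
  ⟨Finset.inter_subset_left, fun _ _ h => h.1, fun _ _ h => h.1⟩

theorem Inseparable.induce_verts {V : Type*} [DecidableEq V] {G : MixedGraph V}
    {S : Finset V} (hS : G.Inseparable S) : (G.induce S).verts = S :=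
  Finset.inter_eq_right.2 hS.1

theorem le_induce_of_verts_subset {V : Type*} [DecidableEq V] {G K : MixedGraph V}
    {S : Finset V} (hK : K ≤ G) (h : K.verts ⊆ S) : K ≤ G.induce S :=
  ⟨Finset.subset_inter hK.1 h,
    fun u v e => ⟨hK.2.1 u v e, h (K.edge_mem u v e).1, h (K.edge_mem u v e).2⟩,
    fun u v e => ⟨hK.2.2 u v e, h (K.arc_mem u v e).1, h (K.arc_mem u v e).2⟩⟩

/-- The vertices of a connected subgraph without cut vertices are inseparable. -/
theorem inseparable_verts {V : Type*} [DecidableEq V] {G K : MixedGraph V} (hK : K ≤ G)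
    (hconn : K.DistanceWellDefined) (hcut : ∀ x, ¬ K.IsCutVertex x) :
    G.Inseparable K.verts := by
  refine ⟨hK.1, fun a ha b hb x hax hbx => ConnAvoiding.mono hK ?_⟩
  by_cases hx : x ∈ K.verts
  · by_contra h
    exact hcut x ⟨hx, deleteVertex_disconnected_iff.2 ⟨a, ha, b, hb, hax, hbx, h⟩⟩
  · refine Relation.ReflTransGen.mono (fun c d hcd => ⟨hcd, ?_, ?_⟩) _ _ (hconn.reachable ha hb)
    · rintro rfl
      exact hx hcd.mem.1
    · rintro rfl
      exact hx hcd.mem.2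

/-- A directed walk of `G` is contracted by the gate map to a directed walk inside `S`. -/
theorem induce_distanceWellDefined {V : Type*} [DecidableEq V] {G : MixedGraph V}
    (hG : G.DistanceWellDefined) {S : Finset V} (hS : Maximal G.Inseparable S)
    (hne : S.Nonempty) : (G.induce S).DistanceWellDefined := by
  refine ⟨by rwa [hS.prop.induce_verts], ?_⟩
  rw [hS.prop.induce_verts]
  intro a ha b hb
  have key : ∀ z, Relation.ReflTransGen G.Step a z → ∀ p, G.IsGate S z p →
      Relation.ReflTransGen (G.induce S).Step a p := by
    intro z hz
    induction hz with
    | refl =>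
      intro p hp
      rw [← hp.eq_of_mem ha]
    | @tail y z hay hyz ih =>
      intro p hp
      obtain ⟨q, hq⟩ := exists_isGate hS ha
        (hG.reachable (hS.prop.1 ha) (Step.mem hyz).1)
      by_cases hyzS : y ∈ S ∧ z ∈ S
      · rw [← hq.eq_of_mem hyzS.1] at hq
        rw [← hp.eq_of_mem hyzS.2]
        exact (ih y hq).tail (hyz.imp (fun h => ⟨h, hyzS⟩) (fun h => ⟨h, hyzS⟩))
      · rw [← hq.eq_of_adj hp (Or.inl hyz)
          (hG.reachable (Step.mem hyz).2 (hS.prop.1 hq.1)) hyzS]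
        exact ih q hq
  exact key b (hG.2 a (hS.prop.1 ha) b (hS.prop.1 hb)) b (isGate_self hb)

/-- A walk of `G` avoiding `x` is contracted by the gate map to a walk inside `S` avoiding
`x`. -/
theorem induce_not_isCutVertex {V : Type*} [DecidableEq V] {G : MixedGraph V}
    (hG : G.DistanceWellDefined) {S : Finset V} (hS : Maximal G.Inseparable S) (x : V) :
    ¬ (G.induce S).IsCutVertex x := by
  rintro ⟨-, hdis⟩
  rw [deleteVertex_disconnected_iff, hS.prop.induce_verts] at hdis
  obtain ⟨a, ha, b, hb, hax, hbx, hnot⟩ := hdis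
  have key : ∀ z, G.ConnAvoiding x a z → ∀ p, G.IsGate S z p →
      (G.induce S).ConnAvoiding x a p := by
    intro z hz
    induction hz with
    | refl =>
      intro p hp
      rw [← hp.eq_of_mem ha]
      exact .refl _ _ _
    | @tail y z hay hyz ih =>
      intro p hp
      obtain ⟨q, hq⟩ := exists_isGate hS ha
        (hG.reachable (hS.prop.1 ha) hyz.1.mem.1)
      by_cases hyzS : y ∈ S ∧ z ∈ S
      · rw [← hq.eq_of_mem hyzS.1] at hq
        rw [← hp.eq_of_mem hyzS.2]
        refine (ih y hq).trans (Adj.connAvoiding ?_ hyz.2.1 hyz.2.2)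
        exact hyz.1.imp (fun h => h.imp (fun h => ⟨h, hyzS⟩) (fun h => ⟨h, hyzS⟩))
          (fun h => h.imp (fun h => ⟨h, hyzS.symm⟩) (fun h => ⟨h, hyzS.symm⟩))
      · rw [← hq.eq_of_adj hp hyz.1
          (hG.reachable hyz.1.mem.2 (hS.prop.1 hq.1)) hyzS]
        exact ih q hq
  exact hnot (key b (hS.prop.2 a ha b hb x hax hbx) b (isGate_self hb))

theorem isBlock_induce {V : Type*} [DecidableEq V] {G : MixedGraph V}
    (hG : G.DistanceWellDefined) {S : Finset V} (hS : Maximal G.Inseparable S)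
    (hcard : 2 ≤ S.card) : G.IsBlock (G.induce S) := by
  refine ⟨⟨G.induce_le S, induce_distanceWellDefined hG hS (Finset.card_pos.1 (by omega)),
    by rwa [hS.prop.induce_verts], induce_not_isCutVertex hG hS⟩, ?_⟩
  rintro K ⟨hK, hconn, -, hcut⟩ hle
  have hsub : S ≤ K.verts := by simpa only [hS.prop.induce_verts] using hle.1
  have heq : S = K.verts := hS.eq_of_le (inseparable_verts hK hconn hcut) hsub
  exact le_induce_of_verts_subset hK heq.ge

theorem IsBlock.exists_eq_induce {V : Type*} [DecidableEq V] {G H : MixedGraph V}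
    (hG : G.DistanceWellDefined) (hH : G.IsBlock H) :
    ∃ S, Maximal G.Inseparable S ∧ H = G.induce S := by
  obtain ⟨hle, hconn, hcard, hcut⟩ := hH.prop
  obtain ⟨S, hHS, hS⟩ := (inseparable_verts hle hconn hcut).exists_maximal
  exact ⟨S, hS, hH.eq_of_le
    (isBlock_induce hG hS (hcard.trans (Finset.card_le_card hHS))).prop
    (le_induce_of_verts_subset hle hHS)⟩

theorem IsBlock.maximal_inseparable {V : Type*} [DecidableEq V] {G H : MixedGraph V}
    (hG : G.DistanceWellDefined) (hH : G.IsBlock H) : Maximal G.Inseparable H.verts := by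
  obtain ⟨S, hS, rfl⟩ := hH.exists_eq_induce hG
  rwa [hS.prop.induce_verts]

/-- A block is determined by its vertex set. -/
theorem IsBlock.eq_of_verts_eq {V : Type*} [DecidableEq V] {G H K : MixedGraph V}
    (hG : G.DistanceWellDefined) (hH : G.IsBlock H) (hK : G.IsBlock K)
    (h : H.verts = K.verts) : H = K := by
  obtain ⟨S, hS, rfl⟩ := hH.exists_eq_induce hG
  obtain ⟨T, hT, rfl⟩ := hK.exists_eq_induce hG
  rw [hS.prop.induce_verts, hT.prop.induce_verts] at h
  rw [h]

theorem IsBlock.exists_isGate {V : Type*} [DecidableEq V] {G H : MixedGraph V}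
    (hG : G.DistanceWellDefined) (hH : G.IsBlock H) {v : V} (hv : v ∈ G.verts) :
    ∃ p, G.IsGate H.verts v p := by
  obtain ⟨s, hs⟩ := hH.prop.2.1.1
  exact MixedGraph.exists_isGate (hH.maximal_inseparable hG) hs
    (hG.reachable (hH.prop.1.1 hs) hv)

theorem Adj.exists_isBlock {V : Type*} [DecidableEq V] {G : MixedGraph V}
    (hG : G.DistanceWellDefined) {a b : V} (h : G.Adj a b) (hab : a ≠ b) :
    ∃ H, G.IsBlock H ∧ a ∈ H.verts ∧ b ∈ H.verts := by
  obtain ⟨S, hsub, hS⟩ := h.inseparable.exists_maximal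
  refine ⟨G.induce S, isBlock_induce hG hS ?_, ?_⟩
  · exact (Finset.card_pair hab).ge.trans (Finset.card_le_card hsub)
  · rw [hS.prop.induce_verts]
    exact ⟨hsub (by simp), hsub (by simp)⟩

/-- A walk from `v` that reaches `u` arrives there, for the first time, from a neighbour. -/
theorem exists_adj_connAvoiding {V : Type*} {G : MixedGraph V} {u v : V} (huv : v ≠ u)
    (hr : Relation.ReflTransGen G.Adj v u) :
    ∃ c, c ≠ u ∧ G.Adj c u ∧ G.ConnAvoiding u v c := by
  by_contra! hcon
  have key : ∀ z, Relation.ReflTransGen G.Adj v z → z ≠ u ∧ G.ConnAvoiding u v z := by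
    intro z hz
    induction hz with
    | refl => exact ⟨huv, .refl _ _ _⟩
    | @tail y z _ hyz ih =>
      have hzu : z ≠ u := by
        rintro rfl
        exact hcon y ih.1 hyz ih.2
      exact ⟨hzu, ih.2.trans (hyz.connAvoiding ih.1 hzu)⟩
  exact (key u hr).1 rfl

/-- Exactly one block at `u` leads towards another vertex `v`: the block containing the last
step of a walk from `v` to `u`. All the others have `u` as their gate. -/
theorem existsUnique_gate_ne {V : Type*} [DecidableEq V] {G : MixedGraph V} {ι : Type*}
    (hG : G.DistanceWellDefined) (S : G.Blocks ι) {u v : V} (hu : u ∈ G.verts)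
    (hv : v ∈ G.verts) (huv : u ≠ v) (g : ι → V)
    (hg : ∀ i, G.IsGate (S.block i).verts v (g i)) :
    ∃! i, u ∈ (S.block i).verts ∧ g i ≠ u := by
  have hblock : ∀ i, G.IsBlock (S.block i) := fun i => (S.isBlock_iff _).2 ⟨i, rfl⟩
  obtain ⟨c, hcu, hadj, hvc⟩ := exists_adj_connAvoiding huv.symm (hG.reachable hv hu)
  obtain ⟨H, hH, hcH, huH⟩ := hadj.exists_isBlock hG hcu
  obtain ⟨i, rfl⟩ := (S.isBlock_iff H).1 hH
  refine ⟨i, ⟨huH, ?_⟩, ?_⟩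
  · intro hgi
    have h := (hg i).2 c hcH
    rw [hgi] at h
    exact h hcu huv.symm hvc
  · rintro j ⟨huj, hgj⟩
    have hconn : G.ConnAvoiding u v (g j) :=
      (hg j).connAvoiding (hG.reachable hv ((hblock j).prop.1.1 (hg j).1)) huj
        (Ne.symm hgj) huv.symm
    apply S.injective
    exact (hblock j).eq_of_verts_eq hG (hblock i)
      (eq_of_maximal_inseparable ((hblock j).maximal_inseparable hG)
        ((hblock i).maximal_inseparable hG) huj huH (hg j).1 hcH hgj hcu
        (hconn.symm.trans hvc))

/-- Distances between `v` and the members of a set split at the gate, which is a cut vertex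
unless the splitting is trivial. -/
theorem IsGeneralizedDistanceMatrix.split {V : Type*} [DecidableEq V] {R : Type*} [CommRing R]
    {G : MixedGraph V} {D : Matrix G.verts G.verts R} (hD : G.IsGeneralizedDistanceMatrix D)
    {S : Finset V} {v p w : G.verts} (hp : G.IsGate S v p) (hw : (w : V) ∈ S) :
    D w v = D w p + D p v ∧ D v w = D v p + D p w := by
  by_cases hwp : w = p
  · subst hwp
    simp [hD.diag]
  by_cases hvp : v = p
  · subst hvp
    simp [hD.diag]
  have hwp' : (w : V) ≠ p := fun h => hwp (Subtype.ext h)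
  have hvp' : (v : V) ≠ p := fun h => hvp (Subtype.ext h)
  have hnot := hp.2 w hw hwp' hvp'
  have hcut : G.IsCutVertex p :=
    ⟨p.2, deleteVertex_disconnected_iff.2 ⟨v, v.2, w, w.2, hvp', hwp', hnot⟩⟩
  constructor
  · refine hD.cut w v p hcut fun q hq => ?_
    by_contra hpq
    exact hnot (hq.1.connAvoiding hpq).symm
  · refine hD.cut v w p hcut fun q hq => ?_
    by_contra hpq
    exact hnot (hq.1.connAvoiding hpq)

end MixedGraph

/-! ### Algebra of the composition bag -/

namespace Bag

/-- The bag with both matrices transposed and the two vectors exchanged. This exchanges left and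
right LapExp* bags. -/
def transpose {n R : Type*} (B : Bag n R) : Bag n R where
  A := B.A.transpose
  lam := B.lam
  α := B.β
  β := B.α
  L := B.L.transpose

theorem isLeftLapExp_transpose_iff {n R : Type*} [Fintype n] [DecidableEq n] [CommRing R]
    {B : Bag n R} : B.transpose.IsLeftLapExp ↔ B.IsRightLapExp := by
  have hmul : B.L.transpose * B.A.transpose + 1 = Matrix.vecMulVec B.α 1 ↔
      B.A * B.L + 1 = Matrix.vecMulVec 1 B.α := by
    rw [← Matrix.transpose_inj, Matrix.transpose_add, Matrix.transpose_mul,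
      Matrix.transpose_transpose, Matrix.transpose_transpose, Matrix.transpose_one,
      Matrix.transpose_vecMulVec]
  constructor
  · rintro ⟨h1, h2, h3, h4⟩
    exact ⟨by rw [dotProduct_comm]; exact h1, by rw [← Matrix.mulVec_transpose]; exact h2,
      by rw [← Matrix.vecMul_transpose]; exact h3, hmul.1 h4⟩
  · rintro ⟨h1, h2, h3, h4⟩
    refine ⟨?_, ?_, ?_, hmul.2 h4⟩
    · rw [dotProduct_comm]
      exact h1
    · exact (Matrix.mulVec_transpose _ _).trans h2
    · exact (Matrix.vecMul_transpose _ _).trans h3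

theorem IsLeftLapExp.inverse_mul {n R : Type*} [Fintype n] [DecidableEq n] [CommRing R]
    {B : Bag n R} (h : B.IsLeftLapExp) {c : Rˣ} (hc : (c : R) = B.lam) :
    (-B.L + ((c⁻¹ : Rˣ) : R) • Matrix.vecMulVec B.β B.α) * B.A = 1 := by
  have hβ : Matrix.vecMulVec B.β B.α * B.A = (c : R) • Matrix.vecMulVec B.β 1 := by
    rw [Matrix.vecMulVec_mul, h.α_A, Matrix.vecMulVec_smul, hc]
  rw [add_mul, neg_mul, Matrix.smul_mul, hβ, smul_smul, Units.inv_mul, one_smul, ← h.L_A]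
  abel

theorem IsRightLapExp.mul_inverse {n R : Type*} [Fintype n] [DecidableEq n] [CommRing R]
    {B : Bag n R} (h : B.IsRightLapExp) {c : Rˣ} (hc : (c : R) = B.lam) :
    B.A * (-B.L + ((c⁻¹ : Rˣ) : R) • Matrix.vecMulVec B.β B.α) = 1 := by
  have hα : B.A * Matrix.vecMulVec B.β B.α = (c : R) • Matrix.vecMulVec 1 B.α := by
    rw [Matrix.mul_vecMulVec, h.A_β, Matrix.smul_vecMulVec, hc]
  rw [mul_add, mul_neg, Matrix.mul_smul, hα, smul_smul, Units.inv_mul, one_smul, ← h.A_L]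
  abel

/-- The composition of left bags over an abstract gate map `g`. The vectors `a i`, `b i` and the
matrices `M i` are extended by zero to all indices. Relative to any base point `v`, each
coefficient `1 - b(u)` of the composition bag is rewritten as minus the number of blocks whose
gate for `v` is `u`, corrected at `u = v`; the sums over `u` then cancel block by block. -/
theorem isLeftLapExp_of_gates {n ι R : Type*} [Fintype n] [DecidableEq n] [Nonempty n]
    [Fintype ι] [CommRing R] (B : Bag n R) (lam : ι → R) (a b : ι → n → R)
    (M : ι → Matrix n n R) (g : ι → n → n) (hdiag : ∀ v, B.A v v = 0)
    (hlam : B.lam = ∑ i, lam i)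
    (hα : ∀ u v, B.α u =
      (∑ i, (a i u - if g i v = u then 1 else 0)) + if u = v then 1 else 0)
    (hβ : ∀ u v, B.β u =
      (∑ i, (b i u - if g i v = u then 1 else 0)) + if u = v then 1 else 0)
    (hL : ∀ u v, B.L u v = ∑ i, M i u v)
    (ha : ∀ i, ∑ u, a i u = 1)
    (haA : ∀ i v, ∑ u, a i u * B.A u v = lam i + B.A (g i v) v)
    (hM : ∀ i u, ∑ w, M i u w = 0)
    (hMA : ∀ i u v, ∑ w, M i u w * B.A w v = b i u - if g i v = u then 1 else 0) :
    B.IsLeftLapExp where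
  α_one := by
    obtain ⟨v⟩ := ‹Nonempty n›
    simp only [dotProduct, Pi.one_apply, mul_one, hα _ v, Finset.sum_add_distrib]
    rw [Finset.sum_comm]
    simp [Finset.sum_sub_distrib, ha]
  L_one := by
    funext u
    simp only [Matrix.mulVec, dotProduct, Pi.one_apply, mul_one, hL]
    rw [Finset.sum_comm]
    simp [hM]
  α_A := by
    funext v
    simp only [Matrix.vecMul, dotProduct, hα _ v, add_mul, Finset.sum_add_distrib,
      Finset.sum_mul, sub_mul]
    rw [Finset.sum_comm]
    simp [Finset.sum_sub_distrib, haA, hdiag, hlam]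
  L_A := by
    ext u v
    simp only [Matrix.add_apply, Matrix.mul_apply, hL, Finset.sum_mul, Matrix.vecMulVec_apply,
      Pi.one_apply, mul_one, hβ u v, Matrix.one_apply]
    rw [Finset.sum_comm]
    simp only [hMA]

end Bag

namespace MixedGraph

theorem sum_extendVec_mul {V : Type*} [DecidableEq V] {R : Type*} [CommRing R]
    {G H : MixedGraph V} (h : H ≤ G) (a : H.verts → R) (f : G.verts → R) :
    ∑ w : G.verts, H.extendVec a w * f w = ∑ w : H.verts, a w * f ⟨w, h.1 w.2⟩ := by
  symm
  refine Finset.sum_of_injOn (fun w : H.verts => (⟨w, h.1 w.2⟩ : G.verts)) ?_ ?_ ?_ ?_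
  · intro x _ y _ hxy
    exact Subtype.ext (Subtype.mk.inj hxy)
  · intro _ _
    simp
  · intro w _ hw
    rw [extendVec, dif_neg, zero_mul]
    intro hwH
    exact hw ⟨⟨w, hwH⟩, by simp, rfl⟩
  · intro w _
    simp [extendVec]

theorem extendVec_of_notMem {V : Type*} [DecidableEq V] {R : Type*} [Zero R]
    {H : MixedGraph V} (a : H.verts → R) {u : V} (hu : u ∉ H.verts) : H.extendVec a u = 0 :=
  dif_neg hu

theorem extendMat_of_mem {V : Type*} [DecidableEq V] {R : Type*} [Zero R]
    {H : MixedGraph V} (M : Matrix H.verts H.verts R) {u : V} (hu : u ∈ H.verts) (w : V) :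
    H.extendMat M u w = H.extendVec (M ⟨u, hu⟩) w := by
  simp [extendMat, extendVec, hu]

theorem extendMat_of_notMem {V : Type*} [DecidableEq V] {R : Type*} [Zero R]
    {H : MixedGraph V} (M : Matrix H.verts H.verts R) {u : V} (hu : u ∉ H.verts) (w : V) :
    H.extendMat M u w = 0 :=
  dif_neg fun h => hu h.1

theorem extendMat_transpose {V : Type*} [DecidableEq V] {R : Type*} [Zero R]
    {H : MixedGraph V} (M : Matrix H.verts H.verts R) (u v : V) :
    H.extendMat M.transpose u v = H.extendMat M v u := by
  simp only [extendMat, Matrix.transpose_apply, and_comm (a := u ∈ H.verts)]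

namespace Blocks

theorem sum_blockIndexSet_extendVec {V : Type*} [DecidableEq V] {R : Type*} [CommRing R]
    {G : MixedGraph V} {ι : Type*} [Fintype ι] (S : G.Blocks ι)
    (a : ∀ i, (S.block i).verts → R) (u : V) :
    ∑ i ∈ S.blockIndexSet u, (S.block i).extendVec (a i) u =
      ∑ i, (S.block i).extendVec (a i) u := by
  refine Finset.sum_subset (Finset.subset_univ _) fun i _ hi => extendVec_of_notMem _ ?_
  simpa [blockIndexSet] using hi

/-- Among the blocks that contain `u`, all have gate `u` if `u = v`, and all but one do
otherwise. -/
theorem sum_gate_eq {V : Type*} [DecidableEq V] {G : MixedGraph V} {ι : Type*} [Fintype ι]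
    (R : Type*) [CommRing R] (hG : G.DistanceWellDefined) (S : G.Blocks ι)
    (g : ι → G.verts → G.verts) (hg : ∀ i (v : G.verts), G.IsGate (S.block i).verts v (g i v))
    (u v : G.verts) :
    ∑ i, (if g i v = u then (1 : R) else 0) =
      (S.blockIndex u : R) - 1 + if u = v then 1 else 0 := by
  classical
  by_cases huv : u = v
  · subst huv
    have h : ∀ i, g i u = u ↔ (u : V) ∈ (S.block i).verts := fun i =>
      ⟨fun h => by simpa only [h] using (hg i u).1,
        fun h => Subtype.ext ((hg i u).eq_of_mem h).symm⟩
    simp [h, blockIndex, blockIndexSet]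
  · obtain ⟨i, hi, hiu⟩ := existsUnique_gate_ne hG S u.2 v.2
      (fun h => huv (Subtype.ext h)) (fun i => (g i v : V)) (fun i => hg i v)
    have h : S.blockIndexSet u = insert i (Finset.univ.filter fun j => g j v = u) := by
      ext j
      simp only [blockIndexSet, Finset.mem_filter, Finset.mem_univ, true_and,
        Finset.mem_insert]
      constructor
      · intro hj
        by_cases hju : g j v = u
        · exact Or.inr hju
        · exact Or.inl (hiu j ⟨hj, fun h => hju (Subtype.ext h)⟩)
      · rintro (rfl | hj)
        · exact hi.1
        · simpa only [hj] using (hg j v).1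
    have hni : i ∉ Finset.univ.filter fun j => g j v = u := by
      simpa using fun h => hi.2 (congrArg Subtype.val h)
    rw [blockIndex, h, Finset.card_insert_of_notMem hni]
    simp [huv]

/-- The composition of left bags is a left bag for any matrix with zero diagonal whose entries
split at gates in their row argument. -/
theorem compositionBag_isLeftLapExp {V : Type*} [DecidableEq V] {R : Type*} [CommRing R]
    {ι : Type*} [Fintype ι] {G : MixedGraph V} (hG : G.DistanceWellDefined) (S : G.Blocks ι)
    {D : Matrix G.verts G.verts R} {B : ∀ i, Bag (S.block i).verts R}
    (g : ι → G.verts → G.verts) (hg : ∀ i (v : G.verts), G.IsGate (S.block i).verts v (g i v))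
    (hdiag : ∀ v, D v v = 0)
    (hsplit : ∀ i (v w : G.verts), (w : V) ∈ (S.block i).verts → D w v = D w (g i v) + D (g i v) v)
    (hB : ∀ i, (B i).A = sub D (S.block_le i)) (hleft : ∀ i, (B i).IsLeftLapExp) :
    (S.compositionBag D B).IsLeftLapExp := by
  have : Nonempty G.verts := hG.1.to_subtype
  have hcoeff : ∀ (a : ∀ i, (S.block i).verts → R) (u v : G.verts),
      (∑ i ∈ S.blockIndexSet u, (S.block i).extendVec (a i) u) - (S.blockIndex u : R) + 1 =
      (∑ i, ((S.block i).extendVec (a i) u - if g i v = u then 1 else 0)) +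
        if u = v then 1 else 0 := by
    intro a u v
    rw [sum_blockIndexSet_extendVec, Finset.sum_sub_distrib, sum_gate_eq R hG S g hg]
    ring
  have hone : ∀ i (a : (S.block i).verts → R),
      ∑ u : G.verts, (S.block i).extendVec a u = ∑ u, a u := fun i a => by
    simpa using sum_extendVec_mul (S.block_le i) a 1
  -- Summing a column of `D` against a vector on a block only sees the gate of that column.
  have hcol : ∀ i (a : (S.block i).verts → R) (v : G.verts),
      ∑ u : G.verts, (S.block i).extendVec a u * D u v =
        Matrix.vecMul a (B i).A ⟨g i v, (hg i v).1⟩ + (∑ u, a u) * D (g i v) v := by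
    intro i a v
    rw [sum_extendVec_mul (S.block_le i) a fun u => D u v, Finset.sum_mul, Matrix.vecMul,
      dotProduct, ← Finset.sum_add_distrib, hB]
    refine Finset.sum_congr rfl fun w _ => ?_
    rw [hsplit i v ⟨w, (S.block_le i).1 w.2⟩ w.2, mul_add]
    rfl
  have hα : ∀ i, ∑ u, (B i).α u = 1 := fun i => by
    simpa [dotProduct] using (hleft i).α_one
  have hL : ∀ i u, ∑ w, (B i).L u w = 0 := fun i u => by
    simpa [Matrix.mulVec, dotProduct] using congrFun (hleft i).L_one u
  refine Bag.isLeftLapExp_of_gates _ (fun i => (B i).lam)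
    (fun i u => (S.block i).extendVec (B i).α u) (fun i u => (S.block i).extendVec (B i).β u)
    (fun i => Matrix.of fun u w => (S.block i).extendMat (B i).L u w) g hdiag rfl
    (hcoeff _) (hcoeff _) (fun _ _ => rfl) ?_ ?_ ?_ ?_
  · intro i
    rw [hone, hα]
  · intro i v
    refine (hcol i _ v).trans ?_
    rw [(hleft i).α_A, hα]
    simp [compositionBag]
  · intro i u
    by_cases hu : (u : V) ∈ (S.block i).verts
    · simp only [Matrix.of_apply, extendMat_of_mem _ hu]
      rw [hone, hL]
    · simp [extendMat_of_notMem _ hu]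
  · intro i u v
    by_cases hu : (u : V) ∈ (S.block i).verts
    · simp only [Matrix.of_apply, extendMat_of_mem _ hu]
      refine (hcol i _ v).trans ?_
      have h := congrFun (congrFun (hleft i).L_A ⟨u, hu⟩) ⟨g i v, (hg i v).1⟩
      rw [Matrix.add_apply, Matrix.vecMulVec_apply, Pi.one_apply, mul_one, Matrix.one_apply,
        Matrix.mul_apply_eq_vecMul] at h
      rw [hL, zero_mul, add_zero, extendVec, dif_pos hu, ← h]
      have hiff : (⟨u, hu⟩ : (S.block i).verts) = ⟨g i v, (hg i v).1⟩ ↔ g i v = u := by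
        rw [Subtype.ext_iff, Subtype.ext_iff, eq_comm]
      simp only [hiff, add_sub_cancel_right]
    · have hgu : g i v ≠ u := by
        rintro rfl
        exact hu (hg i v).1
      simp [extendMat_of_notMem _ hu, extendVec_of_notMem _ hu, hgu]

theorem compositionBag_transpose {V : Type*} [DecidableEq V] {R : Type*} [CommRing R]
    {ι : Type*} [Fintype ι] {G : MixedGraph V} (S : G.Blocks ι) (D : Matrix G.verts G.verts R)
    (B : ∀ i, Bag (S.block i).verts R) :
    S.compositionBag D.transpose (fun i => (B i).transpose) =
      (S.compositionBag D B).transpose := by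
  simp only [compositionBag, Bag.transpose, extendMat_transpose]
  rfl

end Blocks

end MixedGraph

theorem theorem3p3 {V : Type*} [DecidableEq V] {R : Type*} [CommRing R]
    {ι : Type*} [Fintype ι]
    (G : MixedGraph V) (hG : G.DistanceWellDefined) (S : G.Blocks ι)
    (D : Matrix G.verts G.verts R) (hD : G.IsGeneralizedDistanceMatrix D)
    (B : ∀ i, Bag (S.block i).verts R)
    (hB : ∀ i, (B i).A = MixedGraph.sub D (S.block_le i)) :
    ((∀ i, (B i).IsLeftLapExp) →
      (S.compositionBag D B).IsLeftLapExp ∧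
      ∀ c : Rˣ, (c : R) = (S.compositionBag D B).lam →
        IsUnit D ∧
        D⁻¹ = -(S.compositionBag D B).L +
          ((c⁻¹ : Rˣ) : R) • Matrix.vecMulVec (S.compositionBag D B).β
            (S.compositionBag D B).α) ∧
    ((∀ i, (B i).IsRightLapExp) →
      (S.compositionBag D B).IsRightLapExp ∧
      ∀ c : Rˣ, (c : R) = (S.compositionBag D B).lam →
        IsUnit D ∧
        D⁻¹ = -(S.compositionBag D B).L +
          ((c⁻¹ : Rˣ) : R) • Matrix.vecMulVec (S.compositionBag D B).β
            (S.compositionBag D B).α) := by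
  have hblock : ∀ i, G.IsBlock (S.block i) := fun i => (S.isBlock_iff _).2 ⟨i, rfl⟩
  have hgate : ∀ i (v : G.verts), ∃ p : G.verts, G.IsGate (S.block i).verts v p := by
    intro i v
    obtain ⟨p, hp⟩ := (hblock i).exists_isGate hG v.2
    exact ⟨⟨p, (S.block_le i).1 hp.1⟩, hp⟩
  choose g hg using hgate
  have hsplit : ∀ i (v w : G.verts), (w : V) ∈ (S.block i).verts →
      D w v = D w (g i v) + D (g i v) v ∧ D v w = D v (g i v) + D (g i v) w :=
    fun i v w hw => hD.split (hg i v) hw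
  constructor
  · intro hleft
    have h := S.compositionBag_isLeftLapExp hG g hg hD.diag
      (fun i v w hw => (hsplit i v w hw).1) hB hleft
    refine ⟨h, fun c hc => ?_⟩
    have hinv := h.inverse_mul hc
    exact ⟨(Matrix.isUnit_iff_isUnit_det D).2 (Matrix.isUnit_det_of_left_inverse hinv),
      Matrix.inv_eq_left_inv hinv⟩
  · intro hright
    have h := S.compositionBag_isLeftLapExp (D := D.transpose)
      (B := fun i => (B i).transpose) hG g hg hD.diag
      (fun i v w hw => (hsplit i v w hw).2.trans (add_comm _ _))
      (fun i => by rw [Bag.transpose, hB]; rfl)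
      (fun i => Bag.isLeftLapExp_transpose_iff.2 (hright i))
    rw [MixedGraph.Blocks.compositionBag_transpose, Bag.isLeftLapExp_transpose_iff] at h
    refine ⟨h, fun c hc => ?_⟩
    have hinv := h.mul_inverse hc
    exact ⟨(Matrix.isUnit_iff_isUnit_det D).2 (Matrix.isUnit_det_of_right_inverse hinv),
      Matrix.inv_eq_right_inv hinv⟩
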